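/- A \emph{cpo} is a partially ordered set in which every increasing sequence $x_0\le x_1\le\cdots$ has a supremum (a least element is not required); a map between cpos is \emph{Scott-continuous} if it is monotone and preserves these suprema. $\mathbf{CPO}$ is the category of cpos and Scott-continuous maps, with its cartesian products $\times$ and coproducts $+$ (disjoint unions), its homsets being ordered pointwise. A \emph{$\mathbf{CPO}$-category} is a category whose homsets are cpos and whose composition is Scott-continuous in both arguments; a \emph{$\mathbf{CPO}$-functor} is a functor whose action on hom-cpos is Scott-continuous. A morphism $e:X\to Y$ of a $\mathbf{CPO}$-category is an \emph{embedding} if there is $p:Y\to X$ with $p\circ e=\mathrm{id}_X$ and $e\circ p\le\mathrm{id}_Y$; an \emph{e-initial object} is an initial object $0$ such that every morphism $0\to A$ is an embedding. An \emph{LNL-FPC model} consists of: \begin{enumerate} \item a $\mathbf{CPO}$-symmetric monoidal closed category $\mathbf D$ (the tensor product is Scott-continuous on morphisms and the currying bijections $\mathbf D(A\otimes X,Y)\cong\mathbf D(X,[A,Y])$ are isomorphisms of cpos) with finite $\mathbf{CPO}$-coproducts (finite coproducts such that the bijections $\mathbf D(X+Y,Z)\cong\mathbf D(X,Z)\times\mathbf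 D(Y,Z)$ are isomorphisms of cpos), such that $\mathbf D$ has an e-initial object and a colimit of every $\omega$-chain of embeddings; \item a $\mathbf{CPO}$-symmetric monoidal adjunction $F\dashv G$ with $F:\mathbf{CPO}\to\mathbf D$ and $G:\mathbf D\to\mathbf{CPO}$, where $\mathbf{CPO}$ carries its cartesian monoidal structure: $F$ and $G$ are $\mathbf{CPO}$-functors, $F$ is strong symmetric monoidal, $G$ is lax symmetric monoidal, and the unit and counit are monoidal. \end{enumerate} Let $T=G\circ F$ be the induced monad on $\mathbf{CPO}$. An endofunctor $H$ of a category is \emph{algebraically compact} if there is an initial $H$-algebra $\omega:H\Omega\to\Omega$ whose inverse $\omega^{-1}:\Omega\to H\Omega$ is a final $H$-coalgebra. Consider the expressions in one variable $X$ generated by the grammar $$A,B ::= X \mid c \mid T A \mid A\times B \mid A+B ,$$ where $c$ ranges over the cpos. Every expression denotes an endofunctor of $\mathbf{CPO}$: $X$ denotes the identity, $c$ the constant functor at $c$, $TA$ the composite of $T$ with the endofunctor denoted by $A$, and $A\times B$, $A+B$ the pointwise product and coproduct. \textbf{Corollary.} For every LNL-FPC model, if every occurrence of $X$ in an expression $A$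 lies inside a subexpression of the form $TB$, then the endofunctor $\mathbf{CPO}\to\mathbf{CPO}$ denoted by $A$ is algebraically compact. -/

import Mathlib

open CategoryTheory CategoryTheory.Limits MonoidalCategory OmegaCompletePartialOrder

universe v u

/-! ### Algebraically compact endofunctors -/

/-- An endofunctor is algebraically compact if it has an initial algebra `ω : F Ω ⟶ Ω` whose
inverse is a final coalgebra. -/
def AlgebraicallyCompact {C : Type u} [Category.{v} C] (F : C ⥤ C) : Prop :=
  ∃ (Ω : C) (ω : F.obj Ω ≅ Ω),
    Nonempty (IsInitial (⟨Ω, ω.hom⟩ : Endofunctor.Algebra F)) ∧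
      Nonempty (IsTerminal (⟨Ω, ω.inv⟩ : Endofunctor.Coalgebra F))

/-! ### Categories enriched in cpos -/

/-- A category whose homsets are cpos and whose composition is Scott-continuous. -/
class CPOCategory (C : Type u) [Category.{v} C] where
  [homCPO : ∀ X Y : C, OmegaCompletePartialOrder (X ⟶ Y)]
  comp_continuous (X Y Z : C) :
    ωScottContinuous (fun p : (X ⟶ Y) × (Y ⟶ Z) => p.1 ≫ p.2)

attribute [reducible, instance] CPOCategory.homCPO

/-- A functor whose action on hom-cpos is Scott-continuous. -/
def IsCPOFunctor {C D : Type*} [Category* C] [CPOCategory C] [Category* D] [CPOCategory D]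
    (F : C ⥤ D) : Prop :=
  ∀ X Y : C, ωScottContinuous (fun f : X ⟶ Y => F.map f)

/-- `e` is the embedding of an embedding-projection pair. -/
def IsEmbeddingMor {C : Type u} [Category.{v} C] [CPOCategory C] {X Y : C} (e : X ⟶ Y) : Prop :=
  ∃ p : Y ⟶ X, e ≫ p = 𝟙 X ∧ p ≫ e ≤ 𝟙 Y

/-- There is an initial object all of whose outgoing morphisms are embeddings. -/
def HasEInitial (C : Type u) [Category.{v} C] [CPOCategory C] : Prop :=
  ∃ Z : C, Nonempty (IsInitial Z) ∧ ∀ (A : C) (f : Z ⟶ A), IsEmbeddingMor f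

/-- Every `ω`-chain of embeddings has a colimit. -/
def HasOmegaColimitsOverEmbeddings (C : Type u) [Category.{v} C] [CPOCategory C] : Prop :=
  ∀ K : ℕ ⥤ C, (∀ {m n : ℕ} (f : m ⟶ n), IsEmbeddingMor (K.map f)) → HasColimit K

/-- Finite coproducts whose universal property is an isomorphism of cpos. (The bijection
`(X ⟶ Z) × (Y ⟶ Z) ≃ (X ⨿ Y ⟶ Z)` has an automatically continuous inverse, and
`(⊥_ ⟶ Z)` is a singleton.) -/
class HasFiniteCPOCoproducts (C : Type u) [Category.{v} C] [CPOCategory C] : Prop where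
  hasFiniteCoproducts : HasFiniteCoproducts C
  desc_continuous (X Y Z : C) :
    ωScottContinuous (fun p : (X ⟶ Z) × (Y ⟶ Z) => coprod.desc p.1 p.2)

/-- The symmetric monoidal closed structure is enriched in cpos: the tensor product is a
Scott-continuous bifunctor, and the bijections `(A ⊗ X ⟶ Y) ≃ (X ⟶ [A, Y])` are isomorphisms
of cpos. -/
class CPOSymmetricMonoidalClosed (C : Type u) [Category.{v} C] [CPOCategory C]
    [MonoidalCategory C] [SymmetricCategory C] [MonoidalClosed C] : Prop where
  tensor_continuous (X₁ Y₁ X₂ Y₂ : C) :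
    ωScottContinuous (fun p : (X₁ ⟶ Y₁) × (X₂ ⟶ Y₂) => p.1 ⊗ₘ p.2)
  curry_continuous (A X Y : C) :
    ωScottContinuous (fun f : A ⊗ X ⟶ Y => MonoidalClosed.curry f)
  uncurry_continuous (A X Y : C) :
    ωScottContinuous (fun f : X ⟶ (ihom A).obj Y => MonoidalClosed.uncurry f)

/-! ### The category of cpos -/

namespace ωCPO

/-- The pointwise order on Scott-continuous functions. -/
instance instCPOCategory : CPOCategory ωCPO.{u} where
  homCPO X Y := inferInstanceAs (OmegaCompletePartialOrder (X →𝒄 Y))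
  comp_continuous X Y Z := by
    have h : ωScottContinuous
        (fun p : (X →𝒄 Y) × (Y →𝒄 Z) => ContinuousHom.comp p.2 p.1) := by
      refine ωScottContinuous.of_monotone_map_ωSup ⟨?_, fun c => ?_⟩
      · intro p q h x
        exact le_trans (h.2 (p.1 x)) (q.2.monotone (h.1 x))
      · apply ContinuousHom.ext
        intro x
        have h₁ : ωScottContinuous (fun p : (X →𝒄 Y) × (Y →𝒄 Z) => p.2 (p.1 x)) :=
          ContinuousHom.ωScottContinuous_apply Prod.ωScottContinuous_snd
            (ContinuousHom.ωScottContinuous_apply Prod.ωScottContinuous_fst ωScottContinuous.const)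
        exact h₁.map_ωSup c
    exact h

/-- The one-point cpo. -/
def terminalCone : LimitCone (Functor.empty.{0} ωCPO.{u}) where
  cone := asEmptyCone (of PUnit)
  isLimit := IsTerminal.ofUniqueHom (fun _ => ContinuousHom.const PUnit.unit)
    (fun _ _ => ContinuousHom.ext _ _ fun _ => rfl)

/-- The cartesian product with the componentwise order. -/
def prodCone (X Y : ωCPO.{u}) : LimitCone (pair X Y) where
  cone := BinaryFan.mk (P := of (X × Y))
    (ContinuousHom.ofFun Prod.fst Prod.ωScottContinuous_fst)
    (ContinuousHom.ofFun Prod.snd Prod.ωScottContinuous_snd)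
  isLimit := BinaryFan.isLimitMk
    (fun s => ContinuousHom.ofFun (fun x => (s.fst x, s.snd x))
      (Prod.ωScottContinuous.prodMk (ContinuousHom.ωScottContinuous s.fst)
        (ContinuousHom.ωScottContinuous s.snd)))
    (fun _ => rfl) (fun _ => rfl)
    (fun _ _ h₁ h₂ => ContinuousHom.ext _ _ fun x =>
      Prod.ext (ContinuousHom.congr_fun h₁ x) (ContinuousHom.congr_fun h₂ x))

instance instCartesianMonoidalCategory : CartesianMonoidalCategory ωCPO.{u} :=
  .ofChosenFiniteProducts terminalCone prodCone

instance instBraidedCategory : BraidedCategory ωCPO.{u} := .ofCartesianMonoidalCategory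

open scoped Classical in
/-- The supremum of a chain in a disjoint union: a chain stays in the summand of its first
element. -/
noncomputable def sumωSup {α β : Type*} [OmegaCompletePartialOrder α]
    [OmegaCompletePartialOrder β] (c : Chain (α ⊕ β)) : α ⊕ β :=
  if h : ∃ a : Chain α, c = a.map ⟨Sum.inl, Sum.inl_mono⟩ then Sum.inl (ωSup h.choose)
  else if h : ∃ b : Chain β, c = b.map ⟨Sum.inr, Sum.inr_mono⟩ then Sum.inr (ωSup h.choose)
  else c 0

theorem sum_chain_cases {α β : Type*} [OmegaCompletePartialOrder α]
    [OmegaCompletePartialOrder β] (c : Chain (α ⊕ β)) :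
    (∃ a : Chain α, c = a.map ⟨Sum.inl, Sum.inl_mono⟩) ∨
      (∃ b : Chain β, c = b.map ⟨Sum.inr, Sum.inr_mono⟩) := by
  have hle : ∀ n, c 0 ≤ c n := fun n => c.monotone (Nat.zero_le n)
  rcases h0 : c 0 with x | y
  · left
    have h : ∀ n, ∃ a, c n = Sum.inl a := by
      intro n
      have hn := hle n
      rcases hc : c n with a | b
      · exact ⟨a, rfl⟩
      · rw [h0, hc] at hn
        exact absurd hn Sum.not_inl_le_inr
    choose a ha using h
    refine ⟨⟨⟨a, fun m n hmn => ?_⟩⟩, ?_⟩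
    · have := c.monotone hmn
      change c m ≤ c n at this
      rw [ha, ha] at this
      exact Sum.inl_le_inl_iff.1 this
    · apply Chain.ext
      funext n
      exact ha n
  · right
    have h : ∀ n, ∃ b, c n = Sum.inr b := by
      intro n
      have hn := hle n
      rcases hc : c n with a | b
      · rw [h0, hc] at hn
        exact absurd hn Sum.not_inr_le_inl
      · exact ⟨b, rfl⟩
    choose a ha using h
    refine ⟨⟨⟨a, fun m n hmn => ?_⟩⟩, ?_⟩
    · have := c.monotone hmn
      change c m ≤ c n at this
      rw [ha, ha] at this
      exact Sum.inr_le_inr_iff.1 this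
    · apply Chain.ext
      funext n
      exact ha n

theorem isLUB_sumωSup {α β : Type*} [OmegaCompletePartialOrder α]
    [OmegaCompletePartialOrder β] (c : Chain (α ⊕ β)) :
    IsLUB (Set.range c) (sumωSup c) := by
  unfold sumωSup
  split_ifs with h₁ h₂
  · have hs := h₁.choose_spec
    generalize h₁.choose = a at hs
    subst hs
    constructor
    · rintro _ ⟨n, rfl⟩
      exact Sum.inl_le_inl_iff.2 (le_ωSup a n)
    · rintro (x | y) hx
      · refine Sum.inl_le_inl_iff.2 (ωSup_le a x fun n => ?_)
        exact Sum.inl_le_inl_iff.1 (hx ⟨n, rfl⟩)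
      · exact absurd (hx ⟨0, rfl⟩ : Sum.inl (a 0) ≤ Sum.inr y) Sum.not_inl_le_inr
  · have hs := h₂.choose_spec
    generalize h₂.choose = b at hs
    subst hs
    constructor
    · rintro _ ⟨n, rfl⟩
      exact Sum.inr_le_inr_iff.2 (le_ωSup b n)
    · rintro (x | y) hx
      · exact absurd (hx ⟨0, rfl⟩ : Sum.inr (b 0) ≤ Sum.inl x) Sum.not_inr_le_inl
      · refine Sum.inr_le_inr_iff.2 (ωSup_le b y fun n => ?_)
        exact Sum.inr_le_inr_iff.1 (hx ⟨n, rfl⟩)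
  · exact absurd (sum_chain_cases c) (by tauto)

/-- The disjoint union of two cpos, with elements of different summands incomparable. -/
noncomputable instance instSumCPO {α β : Type*} [OmegaCompletePartialOrder α]
    [OmegaCompletePartialOrder β] : OmegaCompletePartialOrder (α ⊕ β) where
  ωSup := sumωSup
  le_ωSup c i := (isLUB_sumωSup c).1 ⟨i, rfl⟩
  ωSup_le c x h := (isLUB_sumωSup c).2 (by rintro _ ⟨i, rfl⟩; exact h i)

theorem ωScottContinuous_of_isLUB {α β : Type*} [OmegaCompletePartialOrder α]
    [OmegaCompletePartialOrder β] {f : α → β} (hf : Monotone f)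
    (h : ∀ c : Chain α, IsLUB (Set.range fun n => f (c n)) (f (ωSup c))) :
    ωScottContinuous f :=
  ωScottContinuous.of_monotone_map_ωSup
    ⟨hf, fun c => (h c).unique (isLUB_range_ωSup (c.map ⟨f, hf⟩))⟩

theorem sumElim_continuous {α β γ : Type*} [OmegaCompletePartialOrder α]
    [OmegaCompletePartialOrder β] [OmegaCompletePartialOrder γ] {f : α → γ} {g : β → γ}
    (hf : ωScottContinuous f) (hg : ωScottContinuous g) : ωScottContinuous (Sum.elim f g) := by
  refine ωScottContinuous_of_isLUB ?_ fun c => ?_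
  · rintro (a | a) (b | b) h
    · exact hf.monotone (Sum.inl_le_inl_iff.1 h)
    · exact absurd h Sum.not_inl_le_inr
    · exact absurd h Sum.not_inr_le_inl
    · exact hg.monotone (Sum.inr_le_inr_iff.1 h)
  · rcases sum_chain_cases c with ⟨a, rfl⟩ | ⟨b, rfl⟩
    · have h : ωSup (a.map ⟨Sum.inl, Sum.inl_mono⟩) = (Sum.inl (ωSup a) : α ⊕ β) := by
        apply eq_of_forall_ge_iff
        rintro (x | y)
        · simp [ωSup_le_iff, Sum.inl_le_inl_iff]
        · simp [ωSup_le_iff]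
      rw [h]
      exact hf.isLUB
    · have h : ωSup (b.map ⟨Sum.inr, Sum.inr_mono⟩) = (Sum.inr (ωSup b) : α ⊕ β) := by
        apply eq_of_forall_ge_iff
        rintro (x | y)
        · simp [ωSup_le_iff]
        · simp [ωSup_le_iff, Sum.inr_le_inr_iff]
      rw [h]
      exact hg.isLUB

theorem inl_continuous {α β : Type*} [OmegaCompletePartialOrder α]
    [OmegaCompletePartialOrder β] : ωScottContinuous (Sum.inl : α → α ⊕ β) := by
  refine ωScottContinuous_of_isLUB Sum.inl_mono fun c => ?_
  constructor
  · rintro _ ⟨n, rfl⟩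
    exact Sum.inl_le_inl_iff.2 (le_ωSup c n)
  · rintro (x | y) hx
    · exact Sum.inl_le_inl_iff.2 (ωSup_le c x fun n => Sum.inl_le_inl_iff.1 (hx ⟨n, rfl⟩))
    · exact absurd (hx ⟨0, rfl⟩) Sum.not_inl_le_inr

theorem inr_continuous {α β : Type*} [OmegaCompletePartialOrder α]
    [OmegaCompletePartialOrder β] : ωScottContinuous (Sum.inr : β → α ⊕ β) := by
  refine ωScottContinuous_of_isLUB Sum.inr_mono fun c => ?_
  constructor
  · rintro _ ⟨n, rfl⟩
    exact Sum.inr_le_inr_iff.2 (le_ωSup c n)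
  · rintro (x | y) hx
    · exact absurd (hx ⟨0, rfl⟩) Sum.not_inr_le_inl
    · exact Sum.inr_le_inr_iff.2 (ωSup_le c y fun n => Sum.inr_le_inr_iff.1 (hx ⟨n, rfl⟩))

/-- The disjoint union as a cocone. -/
noncomputable def sumCofan (X Y : ωCPO.{u}) : BinaryCofan X Y :=
  BinaryCofan.mk (P := of (X ⊕ Y))
    (ContinuousHom.ofFun Sum.inl inl_continuous) (ContinuousHom.ofFun Sum.inr inr_continuous)

/-- The disjoint union is the coproduct of cpos. -/
noncomputable def isColimitSumCofan (X Y : ωCPO.{u}) : IsColimit (sumCofan X Y) :=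
  BinaryCofan.isColimitMk
    (fun s => ContinuousHom.ofFun (Sum.elim s.inl s.inr)
      (sumElim_continuous (ContinuousHom.ωScottContinuous s.inl)
        (ContinuousHom.ωScottContinuous s.inr)))
    (fun _ => rfl) (fun _ => rfl)
    (fun s m h₁ h₂ => ContinuousHom.ext _ _ fun x => by
      rcases x with x | y
      · exact ContinuousHom.congr_fun h₁ x
      · exact ContinuousHom.congr_fun h₂ y)

/-- The coproduct bifunctor `+` on cpos: disjoint union. -/
noncomputable def sumFunctor : ωCPO.{u} × ωCPO.{u} ⥤ ωCPO.{u} where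
  obj P := of (P.1 ⊕ P.2)
  map f := ContinuousHom.ofFun (Sum.map f.1 f.2)
    (sumElim_continuous
      (inl_continuous.comp (ContinuousHom.ωScottContinuous f.1))
      (inr_continuous.comp (ContinuousHom.ωScottContinuous f.2)))
  map_id _ := ContinuousHom.ext _ _ fun x => by rcases x with x | x <;> rfl
  map_comp _ _ := ContinuousHom.ext _ _ fun x => by rcases x with x | x <;> rfl

end ωCPO

/-! ### LNL-FPC models -/

/-- A model of the linear/nonlinear fixpoint calculus with linear category `D`: `D` is a
symmetric monoidal closed category enriched in cpos, with finite enriched coproducts, an e-initial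
object and `ω`-colimits over embeddings, together with an enriched symmetric monoidal adjunction
`F ⊣ G` with the cartesian category of cpos. -/
structure LNLFPCModel (D : Type u) [Category.{v} D] [CPOCategory D] [MonoidalCategory D]
    [SymmetricCategory D] [MonoidalClosed D] where
  closed : CPOSymmetricMonoidalClosed D
  coproducts : HasFiniteCPOCoproducts D
  eInitial : HasEInitial D
  colimits : HasOmegaColimitsOverEmbeddings D
  F : ωCPO.{v} ⥤ D
  G : D ⥤ ωCPO.{v}
  F_cpo : IsCPOFunctor F
  G_cpo : IsCPOFunctor G
  adj : F ⊣ G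
  F_braided : F.Braided
  G_laxBraided : G.LaxBraided
  adj_isMonoidal : adj.IsMonoidal

/-- The monad on cpos induced by the adjunction of a model. -/
def LNLFPCModel.T {D : Type u} [Category.{v} D] [CPOCategory D] [MonoidalCategory D]
    [SymmetricCategory D] [MonoidalClosed D] (M : LNLFPCModel D) : Monad ωCPO.{v} :=
  M.adj.toMonad

/-! ### Functorial expressions -/

/-- Expressions `A, B ::= X | c | T A | A × B | A + B` in one functorial variable `X`, where `c`
ranges over the cpos. -/
inductive FunctorExpr : Type (u + 1)
  | var : FunctorExpr
  | const (c : ωCPO.{u}) : FunctorExpr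
  | monad (A : FunctorExpr) : FunctorExpr
  | prod (A B : FunctorExpr) : FunctorExpr
  | sum (A B : FunctorExpr) : FunctorExpr

namespace FunctorExpr

/-- Every occurrence of the variable lies under an occurrence of `T`. -/
def Guarded : FunctorExpr.{u} → Prop
  | var => False
  | const _ => True
  | monad _ => True
  | prod A B => A.Guarded ∧ B.Guarded
  | sum A B => A.Guarded ∧ B.Guarded

/-- The endofunctor on cpos denoted by an expression, where `T` is the given endofunctor. -/
noncomputable def interp (T : ωCPO.{u} ⥤ ωCPO.{u}) : FunctorExpr.{u} → (ωCPO.{u} ⥤ ωCPO.{u})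
  | var => 𝟭 ωCPO
  | const c => (Functor.const ωCPO).obj c
  | monad A => A.interp T ⋙ T
  | prod A B => Functor.prod' (A.interp T) (B.interp T) ⋙ MonoidalCategory.tensor ωCPO
  | sum A B => Functor.prod' (A.interp T) (B.interp T) ⋙ ωCPO.sumFunctor

end FunctorExpr

/-! ### Suprema of sequences in cpos -/

section Suprema

variable {α β : Type*} [OmegaCompletePartialOrder α] [OmegaCompletePartialOrder β]

/-! `T` is `F` followed by `G`, so a functor that uses its argument only under `T` passes through
`D`. More precisely, a guarded expression denotes `P ⋙ Q` with enriched functors `P : ωCPO ⥤ E` and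
`Q : E ⥤ ωCPO`, where `E` is a finite power of `D` (`exists_factorization`). Algebraic compactness
is invariant under cyclic exchange (`AlgebraicallyCompact.comp_comm`), so it suffices to treat `Q ⋙
P` on `E`. This moves the problem away from cpos, where the initial object is empty and hence not
terminal, into a category with a zero object.

On `E` the classical limit-colimit argument applies. In `D` the e-initial object is a zero object
because `D` is closed and symmetric, and this passes to powers. For an enriched endofunctor `H`, the
chain `Z ⟶ H Z ⟶ ⋯` consists of embeddings. Its colimit `Ω` carries idempotents `ρ n` with supremum
`𝟙 Ω`, and `Ω` is a fixed point of `H` (`exists_minimal_invariant`). Maps out of and into `Ω` exist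
as Kleene fixed points, and are unique because they are determined by their composites with the `ρ
n`. -/

theorem exists_isLUB_of_monotone {c : ℕ → α} (hc : Monotone c) : ∃ x, IsLUB (Set.range c) x :=
  ⟨ωSup ⟨⟨c, hc⟩⟩, isLUB_range_ωSup ⟨⟨c, hc⟩⟩⟩

theorem OmegaCompletePartialOrder.ωScottContinuous.isLUB_range_comp {f : α → β}
    (hf : ωScottContinuous f) {c : ℕ → α} (hc : Monotone c) {x : α}
    (hx : IsLUB (Set.range c) x) : IsLUB (Set.range fun n => f (c n)) (f x) := by
  have h := hf.isLUB (c := ⟨⟨c, hc⟩⟩)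
  rwa [← ωSup_eq_of_isLUB (c := ⟨⟨c, hc⟩⟩) hx] at h

/-- The supremum of an increasing sequence does not change when its first term is dropped. -/
theorem IsLUB.range_succ {c : ℕ → α} (hc : Monotone c) {x : α} (hx : IsLUB (Set.range c) x) :
    IsLUB (Set.range fun n => c (n + 1)) x :=
  ⟨by rintro _ ⟨n, rfl⟩; exact hx.1 ⟨n + 1, rfl⟩,
    fun _ hy => hx.2 (by rintro _ ⟨n, rfl⟩; exact (hc n.le_succ).trans (hy ⟨n, rfl⟩))⟩

/-- An increasing sequence that is eventually constant attains its supremum. -/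
theorem IsLUB.eq_of_eventually_const {c : ℕ → α} (hc : Monotone c) {x y : α}
    (hx : IsLUB (Set.range c) x) (k : ℕ) (h : ∀ n, k ≤ n → c n = y) : x = y := by
  refine hx.unique ⟨?_, fun z hz => h k le_rfl ▸ hz ⟨k, rfl⟩⟩
  rintro _ ⟨n, rfl⟩
  exact (hc (le_max_right k n)).trans (h _ (le_max_left k n)).le

/-- Order and suprema of Scott-continuous maps are pointwise, so continuity on homsets of cpos can
be checked at one argument at a time. -/
theorem ωScottContinuous_continuousHom {γ : Type*} [OmegaCompletePartialOrder γ]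
    {f : α → (β →𝒄 γ)} (h : ∀ x, ωScottContinuous fun a => f a x) : ωScottContinuous f :=
  ωScottContinuous.of_monotone_map_ωSup
    ⟨fun _ _ hab x => (h x).monotone hab,
      fun c => ContinuousHom.ext _ _ fun x => (h x).map_ωSup c⟩

end Suprema

/-! ### Composition and functors in categories enriched in cpos -/

section Enriched

variable {C : Type*} [Category* C] [CPOCategory C]

theorem CPOCategory.continuous_comp_left {X Y : C} (f : X ⟶ Y) (Z : C) :
    ωScottContinuous (fun g : Y ⟶ Z => f ≫ g) :=
  (CPOCategory.comp_continuous X Y Z).comp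
    (Prod.ωScottContinuous.prodMk ωScottContinuous.const ωScottContinuous.id)

theorem CPOCategory.continuous_comp_right (X : C) {Y Z : C} (g : Y ⟶ Z) :
    ωScottContinuous (fun f : X ⟶ Y => f ≫ g) :=
  (CPOCategory.comp_continuous X Y Z).comp
    (Prod.ωScottContinuous.prodMk ωScottContinuous.id ωScottContinuous.const)

theorem CPOCategory.comp_mono {X Y Z : C} {f f' : X ⟶ Y} {g g' : Y ⟶ Z} (hf : f ≤ f')
    (hg : g ≤ g') : f ≫ g ≤ f' ≫ g' :=
  (CPOCategory.comp_continuous X Y Z).monotone (a := (f, g)) (b := (f', g')) ⟨hf, hg⟩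

theorem CPOCategory.comp_eq_of_eventually_const {X Y Z : C} {c : ℕ → (Y ⟶ Z)} (hc : Monotone c)
    {x : Y ⟶ Z} (hx : IsLUB (Set.range c) x) (f : X ⟶ Y) {g : X ⟶ Z} (k : ℕ)
    (h : ∀ n, k ≤ n → f ≫ c n = g) : f ≫ x = g :=
  have hf := CPOCategory.continuous_comp_left f Z
  (hf.isLUB_range_comp hc hx).eq_of_eventually_const (fun _ _ hmn => hf.monotone (hc hmn)) k h

theorem IsEmbeddingMor.id (X : C) : IsEmbeddingMor (𝟙 X) :=
  ⟨𝟙 X, by simp, by simp⟩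

theorem IsEmbeddingMor.comp {X Y Z : C} {f : X ⟶ Y} {g : Y ⟶ Z} (hf : IsEmbeddingMor f)
    (hg : IsEmbeddingMor g) : IsEmbeddingMor (f ≫ g) := by
  obtain ⟨p, hp, hp'⟩ := hf
  obtain ⟨q, hq, hq'⟩ := hg
  refine ⟨q ≫ p, by simp [reassoc_of% hq, hp], ?_⟩
  have h := CPOCategory.comp_mono (le_refl q) (CPOCategory.comp_mono hp' (le_refl g))
  simp only [Category.assoc, Category.id_comp] at h ⊢
  exact h.trans hq'

theorem isEmbeddingMor_ofSequence {X : ℕ → C} (f : ∀ n, X n ⟶ X (n + 1))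
    (hf : ∀ n, IsEmbeddingMor (f n)) {m n : ℕ} (φ : m ⟶ n) :
    IsEmbeddingMor ((Functor.ofSequence f).map φ) := by
  obtain ⟨k, rfl⟩ := Nat.exists_eq_add_of_le (leOfHom φ)
  induction k with
  | zero =>
    obtain rfl := Subsingleton.elim φ (𝟙 m)
    rw [CategoryTheory.Functor.map_id]
    exact IsEmbeddingMor.id _
  | succ k ih =>
    obtain rfl := Subsingleton.elim φ
      (homOfLE (Nat.le_add_right m k) ≫ homOfLE (Nat.le_add_right (m + k) 1))
    rw [Functor.map_comp, Functor.ofSequence_map_homOfLE_succ]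
    exact (ih _).comp (hf _)

theorem IsCPOFunctor.id : IsCPOFunctor (𝟭 C) := fun _ _ => ωScottContinuous.id

variable {D E : Type*} [Category* D] [CPOCategory D] [Category* E] [CPOCategory E]

theorem IsCPOFunctor.comp {F : C ⥤ D} {G : D ⥤ E} (hF : IsCPOFunctor F) (hG : IsCPOFunctor G) :
    IsCPOFunctor (F ⋙ G) :=
  fun _ _ => (hG _ _).comp (hF _ _)

theorem IsCPOFunctor.const (X : D) : IsCPOFunctor ((Functor.const C).obj X) :=
  fun _ _ => ωScottContinuous.const

/-- The product of two categories enriched in cpos, with the componentwise order. -/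
instance CPOCategory.prod : CPOCategory (C × D) where
  homCPO X Y := inferInstanceAs (OmegaCompletePartialOrder ((X.1 ⟶ Y.1) × (X.2 ⟶ Y.2)))
  comp_continuous X Y Z :=
    Prod.ωScottContinuous.prodMk
      ((CPOCategory.comp_continuous X.1 Y.1 Z.1).comp
        (Prod.ωScottContinuous.prodMk (Prod.ωScottContinuous_fst.comp Prod.ωScottContinuous_fst)
          (Prod.ωScottContinuous_fst.comp Prod.ωScottContinuous_snd)))
      ((CPOCategory.comp_continuous X.2 Y.2 Z.2).comp
        (Prod.ωScottContinuous.prodMk (Prod.ωScottContinuous_snd.comp Prod.ωScottContinuous_fst)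
          (Prod.ωScottContinuous_snd.comp Prod.ωScottContinuous_snd)))

theorem IsCPOFunctor.prod' {F : C ⥤ D} {G : C ⥤ E} (hF : IsCPOFunctor F) (hG : IsCPOFunctor G) :
    IsCPOFunctor (Functor.prod' F G) :=
  fun X Y => Prod.ωScottContinuous.prodMk (hF X Y) (hG X Y)

theorem IsCPOFunctor.prod {B : Type*} [Category* B] [CPOCategory B] {F : B ⥤ C} {G : D ⥤ E}
    (hF : IsCPOFunctor F) (hG : IsCPOFunctor G) : IsCPOFunctor (F.prod G) :=
  fun X Y => Prod.ωScottContinuous.prodMk ((hF X.1 Y.1).comp Prod.ωScottContinuous_fst)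
    ((hG X.2 Y.2).comp Prod.ωScottContinuous_snd)

end Enriched

/-! ### Algebraic compactness of enriched endofunctors -/

/-- A category enriched in cpos has an e-zero object if it has a zero object all of whose outgoing
morphisms are embeddings. -/
def HasEZero (C : Type u) [Category.{v} C] [CPOCategory C] : Prop :=
  ∃ Z : C, Nonempty (IsInitial Z) ∧ Nonempty (IsTerminal Z) ∧
    ∀ (A : C) (f : Z ⟶ A), IsEmbeddingMor f

section Compactness

variable {C : Type u} [Category.{v} C] [CPOCategory C]

/-- The initial sequence of an endofunctor has a colimit with projections exhibiting the identity
as a supremum, and this colimit is a fixed point. -/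
theorem exists_minimal_invariant (hC : HasOmegaColimitsOverEmbeddings C) {Z : C}
    (hi : IsInitial Z) (ht : IsTerminal Z) (he : ∀ (A : C) (f : Z ⟶ A), IsEmbeddingMor f)
    (H : C ⥤ C) (hH : IsCPOFunctor H) :
    ∃ (Ω : C) (ω : H.obj Ω ≅ Ω) (ρ : ℕ → (Ω ⟶ Ω)), Monotone ρ ∧ IsLUB (Set.range ρ) (𝟙 Ω) ∧
      ρ 0 = ht.from Ω ≫ hi.to Ω ∧ ∀ n, ρ (n + 1) = ω.inv ≫ H.map (ρ n) ≫ ω.hom := by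
  let X : ℕ → C := fun n => Nat.rec Z (fun _ Y => H.obj Y) n
  let e : ∀ n, X n ⟶ X (n + 1) :=
    fun n => Nat.rec (motive := fun n => X n ⟶ X (n + 1)) (hi.to _) (fun _ f => H.map f) n
  let p : ∀ n, X (n + 1) ⟶ X n :=
    fun n => Nat.rec (motive := fun n => X (n + 1) ⟶ X n) (ht.from _) (fun _ f => H.map f) n
  have e_succ : ∀ n, e (n + 1) = H.map (e n) := fun _ => rfl
  have p_succ : ∀ n, p (n + 1) = H.map (p n) := fun _ => rfl
  -- Nothing is lost at index 0: there the maps are determined by `Z` being initial and terminal.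
  clear_value e p
  have hep : ∀ n, e n ≫ p n = 𝟙 _ := by
    intro n
    induction n with
    | zero => exact hi.hom_ext _ _
    | succ n ih => rw [e_succ, p_succ, ← H.map_comp, ih, H.map_id]
  have hpe : ∀ n, p n ≫ e n ≤ 𝟙 _ := by
    intro n
    induction n with
    | zero =>
      obtain ⟨q, -, hq⟩ := he (X 1) (e 0)
      rwa [show p 0 = q from ht.hom_ext _ _]
    | succ n ih =>
      have h := (hH _ _).monotone ih
      rw [H.map_comp, H.map_id] at h
      rw [e_succ, p_succ]
      exact h
  let K := Functor.ofSequence e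
  have := hC K (isEmbeddingMor_ofSequence e fun n => ⟨p n, hep n, hpe n⟩)
  let Ω : C := colimit K
  let ι : ∀ n, X n ⟶ Ω := fun n => colimit.ι K n
  have hι : ∀ n, e n ≫ ι (n + 1) = ι n := by
    intro n
    have h := colimit.w K (homOfLE (Nat.le_add_right n 1))
    rwa [Functor.ofSequence_map_homOfLE_succ] at h
  have ι_ext : ∀ {Y : C} (f g : Ω ⟶ Y), (∀ n, ι n ≫ f = ι n ≫ g) → f = g :=
    fun f g h => colimit.hom_ext h
  -- `H (ι n)` starts at `X (n + 1)`, so the leg at `X n` must first move one step along the chain;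
  -- `X 0` is not a value of `H`.
  obtain ⟨u, hu⟩ : ∃ u : Ω ⟶ H.obj Ω, ∀ n, ι (n + 1) ≫ u = H.map (ι n) := by
    let g : ∀ n, X n ⟶ H.obj Ω := fun n => e n ≫ H.map (ι n)
    have hg : ∀ n, e n ≫ g (n + 1) = g n := fun n => by
      simp only [g]
      rw [e_succ n, ← H.map_comp, hι]
    let s : Cocone K := ⟨H.obj Ω, NatTrans.ofSequence g fun n => by
      rw [Functor.ofSequence_map_homOfLE_succ]
      exact (hg n).trans (Category.comp_id _).symm⟩
    refine ⟨colimit.desc K s, fun n => (colimit.ι_desc s (n + 1)).trans ?_⟩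
    change e (n + 1) ≫ H.map (ι (n + 1)) = _
    rw [e_succ, ← H.map_comp, hι]
  -- Defining the projections by recursion through `u` builds in the relation between `ρ (n + 1)`
  -- and `H.map (ρ n)`.
  let π : ∀ n, Ω ⟶ X n :=
    fun n => Nat.rec (motive := fun n => Ω ⟶ X n) (ht.from _) (fun _ f => u ≫ H.map f) n
  have π_succ : ∀ n, π (n + 1) = u ≫ H.map (π n) := fun _ => rfl
  have π_zero : π 0 = ht.from Ω := rfl
  clear_value π
  have hιπ : ∀ n, ι n ≫ π n = 𝟙 _ := by
    intro n
    induction n with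
    | zero => exact hi.hom_ext _ _
    | succ n ih =>
      rw [π_succ, ← Category.assoc, hu, ← H.map_comp, ih, H.map_id]
  have hπ : ∀ n, π (n + 1) ≫ p n = π n := by
    intro n
    induction n with
    | zero => exact ht.hom_ext _ _
    | succ n ih =>
      rw [π_succ (n + 1), p_succ, Category.assoc, ← H.map_comp, ih, π_succ]
  have step : ∀ n, π n ≫ ι n = π (n + 1) ≫ (p n ≫ e n) ≫ ι (n + 1) := by
    intro n
    rw [Category.assoc, hι, ← Category.assoc, hπ]
  have hρ : Monotone fun n => π n ≫ ι n := by
    refine monotone_nat_of_le_succ fun n => ?_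
    rw [step]
    simpa using CPOCategory.comp_mono (le_refl (π (n + 1)))
      (CPOCategory.comp_mono (hpe n) (le_refl (ι (n + 1))))
  have factor : ∀ k n, k ≤ n → ∃ f : X k ⟶ X n, f ≫ ι n = ι k :=
    fun k n h => ⟨K.map (homOfLE h), colimit.w K _⟩
  -- The supremum agrees with the identity on each leg `ι k`, since `ι k ≫ π n ≫ ι n = ι k` once `k
  -- ≤ n`.
  have hsup : IsLUB (Set.range fun n => π n ≫ ι n) (𝟙 Ω) := by
    obtain ⟨σ, hσ⟩ := exists_isLUB_of_monotone hρ
    rwa [show 𝟙 Ω = σ from ?_]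
    refine ι_ext _ _ fun k => ?_
    rw [Category.comp_id]
    refine (CPOCategory.comp_eq_of_eventually_const hρ hσ (ι k) k fun n hn => ?_).symm
    obtain ⟨f, hf⟩ := factor k n hn
    rw [← hf, Category.assoc]
    rw [← Category.assoc (ι n), hιπ, Category.id_comp]
  -- `H` is not known to preserve the colimit, so the inverse of `u` is obtained as the supremum of
  -- these maps. Composing them with `u` gives `ρ (n + 1)` on one side and `H.map (ρ n)` on the
  -- other, and both sequences have supremum an identity.
  have hv : Monotone fun n => H.map (π n) ≫ ι (n + 1) := by
    refine monotone_nat_of_le_succ fun n => ?_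
    have h := CPOCategory.comp_mono (le_refl (H.map (π (n + 1))))
      (CPOCategory.comp_mono (hpe (n + 1)) (le_refl (ι (n + 1 + 1))))
    rw [Category.id_comp, Category.assoc, hι, p_succ, ← Category.assoc, ← H.map_comp, hπ] at h
    exact h
  obtain ⟨w, hw⟩ := exists_isLUB_of_monotone hv
  have huw : u ≫ w = 𝟙 Ω := by
    refine ((CPOCategory.continuous_comp_left u Ω).isLUB_range_comp hv hw).unique ?_
    convert hsup.range_succ hρ using 3 with n
    rw [π_succ, Category.assoc]
  have hwu : w ≫ u = 𝟙 _ := by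
    refine ((CPOCategory.continuous_comp_right _ u).isLUB_range_comp hv hw).unique ?_
    have h := (hH _ _).isLUB_range_comp hρ hsup
    rw [H.map_id] at h
    convert h using 3 with n
    rw [Category.assoc, hu, H.map_comp]
  refine ⟨Ω, ⟨w, u, hwu, huw⟩, fun n => π n ≫ ι n, hρ, hsup, ?_, fun n => ?_⟩
  · exact congrArg₂ (· ≫ ·) π_zero (hi.hom_ext _ _)
  · have h : ι (n + 1) = H.map (ι n) ≫ w := by
      rw [← hu, Category.assoc, huw, Category.comp_id]
    change π (n + 1) ≫ ι (n + 1) = u ≫ H.map (π n ≫ ι n) ≫ w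
    rw [h, π_succ, H.map_comp]
    simp only [Category.assoc]

/-- In a category enriched in cpos with an e-zero object and `ω`-colimits over embeddings, every
enriched endofunctor is algebraically compact. -/
theorem IsCPOFunctor.algebraicallyCompact (hC : HasOmegaColimitsOverEmbeddings C)
    (hZ : HasEZero C) {H : C ⥤ C} (hH : IsCPOFunctor H) : AlgebraicallyCompact H := by
  obtain ⟨Z, ⟨hi⟩, ⟨ht⟩, he⟩ := hZ
  obtain ⟨Ω, ω, ρ, hρ, hsup, hρ₀, hρs⟩ := exists_minimal_invariant hC hi ht he H hH
  let bot : ∀ X Y : C, X ⟶ Y := fun X Y => ht.from X ≫ hi.to Y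
  -- Projecting `X` to `Z` and embedding back is below `𝟙 X`; composing with `f` turns the left side
  -- into the zero morphism.
  have bot_le : ∀ {X Y : C} (f : X ⟶ Y), bot X Y ≤ f := by
    intro X Y f
    obtain ⟨q, -, hq⟩ := he X (hi.to X)
    have h := CPOCategory.comp_mono hq (le_refl f)
    rw [show q = ht.from X from ht.hom_ext _ _, Category.assoc,
      show hi.to X ≫ f = hi.to Y from hi.hom_ext _ _, Category.id_comp] at h
    exact h
  have bot_comp : ∀ {X Y W : C} (f : Y ⟶ W), bot X Y ≫ f = bot X W := fun f => by
    simp only [bot, Category.assoc]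
    exact congrArg _ (hi.hom_ext _ _)
  have comp_bot : ∀ {X Y W : C} (f : X ⟶ Y), f ≫ bot Y W = bot X W := fun f => by
    simp only [bot, ← Category.assoc]
    exact congrArg (· ≫ _) (ht.hom_ext _ _)
  have fix : ∀ {X Y : C} (Φ : (X ⟶ Y) → (X ⟶ Y)), ωScottContinuous Φ → ∃ h, h = Φ h := by
    intro X Y Φ hΦ
    have hmono : Monotone fun n => Φ^[n] (bot X Y) := by
      refine monotone_nat_of_le_succ fun n => ?_
      rw [Function.iterate_succ_apply]
      exact hΦ.monotone.iterate n (bot_le _)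
    obtain ⟨h, hh⟩ := exists_isLUB_of_monotone hmono
    refine ⟨h, (hh.range_succ hmono).unique ?_⟩
    simpa only [Function.iterate_succ_apply'] using hΦ.isLUB_range_comp hmono hh
  refine ⟨Ω, ω, ⟨?_⟩, ⟨?_⟩⟩
  · have ex : ∀ A : Endofunctor.Algebra H, ∃ h : Ω ⟶ A.a, h = ω.inv ≫ H.map h ≫ A.str := fun A =>
      fix _ (((CPOCategory.continuous_comp_left ω.inv _).comp
        (CPOCategory.continuous_comp_right _ A.str)).comp (hH _ _))
    -- `ρ (n + 1) ≫ h` unfolds to `ω.inv ≫ H.map (ρ n ≫ h) ≫ A.str`, so two solutions agree after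
    -- each `ρ n`, hence after the supremum `𝟙 Ω`.
    have uniq : ∀ (A : Endofunctor.Algebra H) (h k : Ω ⟶ A.a), h = ω.inv ≫ H.map h ≫ A.str →
        k = ω.inv ≫ H.map k ≫ A.str → h = k := by
      intro A h k hh hk
      have hn : ∀ n, ρ n ≫ h = ρ n ≫ k := by
        intro n
        induction n with
        | zero => rw [hρ₀]; exact (bot_comp h).trans (bot_comp k).symm
        | succ n ih =>
          conv_lhs => rw [hh]
          conv_rhs => rw [hk]
          simp only [hρs, Category.assoc, Iso.hom_inv_id_assoc]
          rw [← H.map_comp_assoc, ih, H.map_comp_assoc]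
      have h₁ := (CPOCategory.continuous_comp_right Ω h).isLUB_range_comp hρ hsup
      have h₂ := (CPOCategory.continuous_comp_right Ω k).isLUB_range_comp hρ hsup
      simp only [hn, Category.id_comp] at h₁ h₂
      exact h₁.unique h₂
    choose h hh using ex
    exact IsInitial.ofUniqueHom (fun A => ⟨h A, by
        conv_rhs => rw [hh A]
        simp⟩)
      fun A m => Endofunctor.Algebra.ext (uniq A _ _ (by
        have := m.h
        rw [this, Iso.inv_hom_id_assoc]) (hh A))
  · have ex : ∀ A : Endofunctor.Coalgebra H, ∃ h : A.V ⟶ Ω, h = A.str ≫ H.map h ≫ ω.hom := fun A =>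
      fix _ (((CPOCategory.continuous_comp_left A.str _).comp
        (CPOCategory.continuous_comp_right _ ω.hom)).comp (hH _ _))
    have uniq : ∀ (A : Endofunctor.Coalgebra H) (h k : A.V ⟶ Ω), h = A.str ≫ H.map h ≫ ω.hom →
        k = A.str ≫ H.map k ≫ ω.hom → h = k := by
      intro A h k hh hk
      have hn : ∀ n, h ≫ ρ n = k ≫ ρ n := by
        intro n
        induction n with
        | zero => rw [hρ₀]; exact (comp_bot h).trans (comp_bot k).symm
        | succ n ih =>
          conv_lhs => rw [hh]
          conv_rhs => rw [hk]
          simp only [hρs, Category.assoc, Iso.hom_inv_id_assoc]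
          rw [← H.map_comp_assoc, ih, H.map_comp_assoc]
      have h₁ := (CPOCategory.continuous_comp_left h Ω).isLUB_range_comp hρ hsup
      have h₂ := (CPOCategory.continuous_comp_left k Ω).isLUB_range_comp hρ hsup
      simp only [hn, Category.comp_id] at h₁ h₂
      exact h₁.unique h₂
    choose h hh using ex
    exact IsTerminal.ofUniqueHom (fun A => ⟨h A, by
        conv_rhs => rw [hh A]
        simp⟩)
      fun A m => Endofunctor.Coalgebra.ext (uniq A _ _ (by
        have := m.h
        rw [reassoc_of% this, Iso.inv_hom_id, Category.comp_id]) (hh A))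

end Compactness

/-- Algebraic compactness is invariant under exchanging the factors of a composite. -/
theorem AlgebraicallyCompact.comp_comm {C D : Type*} [Category* C] [Category* D] {P : C ⥤ D}
    {Q : D ⥤ C} (h : AlgebraicallyCompact (Q ⋙ P)) : AlgebraicallyCompact (P ⋙ Q) := by
  obtain ⟨Ω, ω, ⟨hi⟩, ⟨ht⟩⟩ := h
  refine ⟨Q.obj Ω, Q.mapIso ω, ⟨?_⟩, ⟨?_⟩⟩
  · let alg (A : Endofunctor.Algebra (P ⋙ Q)) : Endofunctor.Algebra (Q ⋙ P) :=
      ⟨P.obj A.a, P.map A.str⟩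
    refine IsInitial.ofUniqueHom (fun A => ⟨Q.map (hi.to (alg A)).f ≫ A.str, ?_⟩) fun A m => ?_
    · have := congrArg (fun f => Q.map f ≫ A.str) (hi.to (alg A)).h
      simpa [alg] using this
    -- A competing `m` transposes to an algebra map `ω.inv ≫ P.map m.f` out of `Ω`. Initiality
    -- identifies it, and applying `Q` followed by `A.str` recovers `m`.
    · have hm : Q.map (P.map m.f) ≫ A.str = Q.map ω.hom ≫ m.f := m.h
      let k : (⟨Ω, ω.hom⟩ : Endofunctor.Algebra (Q ⋙ P)) ⟶ alg A := ⟨ω.inv ≫ P.map m.f, by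
        simp only [alg, Functor.comp_map, Functor.map_comp, Category.assoc, Iso.hom_inv_id_assoc]
        rw [← P.map_comp (Q.map (P.map m.f)), hm, ← P.map_comp, ← Q.map_comp_assoc]
        simp⟩
      apply Endofunctor.Algebra.ext
      have hk : (hi.to (alg A)).f = ω.inv ≫ P.map m.f := congrArg (·.f) (hi.hom_ext _ k)
      change _ = Q.map (hi.to (alg A)).f ≫ A.str
      rw [hk, Q.map_comp, Category.assoc, hm, ← Q.map_comp_assoc]
      simp
  · let coalg (A : Endofunctor.Coalgebra (P ⋙ Q)) : Endofunctor.Coalgebra (Q ⋙ P) :=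
      ⟨P.obj A.V, P.map A.str⟩
    refine IsTerminal.ofUniqueHom (fun A => ⟨A.str ≫ Q.map (ht.from (coalg A)).f, ?_⟩) fun A m => ?_
    · have := congrArg (fun f => A.str ≫ Q.map f) (ht.from (coalg A)).h
      simpa [coalg] using this
    · have hm : A.str ≫ Q.map (P.map m.f) = m.f ≫ Q.map ω.inv := m.h
      let k : coalg A ⟶ (⟨Ω, ω.inv⟩ : Endofunctor.Coalgebra (Q ⋙ P)) := ⟨P.map m.f ≫ ω.hom, by
        simp only [coalg, Functor.comp_map, Functor.map_comp, Category.assoc, Iso.hom_inv_id,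
          Category.comp_id]
        rw [← P.map_comp_assoc, hm]
        simp [← Functor.map_comp]⟩
      apply Endofunctor.Coalgebra.ext
      have hk : (ht.from (coalg A)).f = P.map m.f ≫ ω.hom := congrArg (·.f) (ht.hom_ext _ k)
      change _ = A.str ≫ Q.map (ht.from (coalg A)).f
      rw [hk, Q.map_comp, reassoc_of% hm, ← Q.map_comp]
      simp

/-! ### e-zero objects and colimits in products -/

section Products

variable {C D : Type*} [Category* C] [CPOCategory C] [Category* D] [CPOCategory D]

theorem IsEmbeddingMor.fst {X Y : C × D} {f : X ⟶ Y} (hf : IsEmbeddingMor f) :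
    IsEmbeddingMor f.1 := by
  obtain ⟨p, h, h'⟩ := hf
  exact ⟨p.1, congrArg (·.1) h, h'.1⟩

theorem IsEmbeddingMor.snd {X Y : C × D} {f : X ⟶ Y} (hf : IsEmbeddingMor f) :
    IsEmbeddingMor f.2 := by
  obtain ⟨p, h, h'⟩ := hf
  exact ⟨p.2, congrArg (·.2) h, h'.2⟩

theorem HasEZero.prod (hC : HasEZero C) (hD : HasEZero D) : HasEZero (C × D) := by
  obtain ⟨Z, ⟨hi⟩, ⟨ht⟩, he⟩ := hC
  obtain ⟨W, ⟨hi'⟩, ⟨ht'⟩, he'⟩ := hD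
  refine ⟨(Z, W),
    ⟨IsInitial.ofUniqueHom (fun A => (hi.to A.1, hi'.to A.2)) fun A m =>
      Prod.ext (hi.hom_ext _ _) (hi'.hom_ext _ _)⟩,
    ⟨IsTerminal.ofUniqueHom (fun A => (ht.from A.1, ht'.from A.2)) fun A m =>
      Prod.ext (ht.hom_ext _ _) (ht'.hom_ext _ _)⟩, fun A f => ?_⟩
  obtain ⟨p, h₁, h₂⟩ := he A.1 f.1
  obtain ⟨q, h₃, h₄⟩ := he' A.2 f.2
  exact ⟨(p, q), Prod.ext h₁ h₃, h₂, h₄⟩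

theorem HasOmegaColimitsOverEmbeddings.prod (hC : HasOmegaColimitsOverEmbeddings C)
    (hD : HasOmegaColimitsOverEmbeddings D) : HasOmegaColimitsOverEmbeddings (C × D) := by
  intro K hK
  have := hC (K ⋙ CategoryTheory.Prod.fst C D) fun f => (hK f).fst
  have := hD (K ⋙ CategoryTheory.Prod.snd C D) fun f => (hK f).snd
  let s := colimit.cocone (K ⋙ CategoryTheory.Prod.fst C D)
  let t := colimit.cocone (K ⋙ CategoryTheory.Prod.snd C D)
  let hs : IsColimit s := colimit.isColimit _
  let ht : IsColimit t := colimit.isColimit _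
  exact ⟨⟨{
    cocone := ⟨(s.pt, t.pt),
      { app := fun n => (s.ι.app n, t.ι.app n)
        naturality := fun _ _ f => Prod.ext (s.ι.naturality f) (t.ι.naturality f) }⟩
    isColimit :=
      { desc := fun c => (hs.desc ((CategoryTheory.Prod.fst C D).mapCocone c),
          ht.desc ((CategoryTheory.Prod.snd C D).mapCocone c))
        fac := fun c n => Prod.ext (hs.fac ((CategoryTheory.Prod.fst C D).mapCocone c) n)
          (ht.fac ((CategoryTheory.Prod.snd C D).mapCocone c) n)
        uniq := fun c m h => Prod.ext
          (hs.uniq ((CategoryTheory.Prod.fst C D).mapCocone c) m.1 fun n => congrArg (·.1) (h n))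
          (ht.uniq ((CategoryTheory.Prod.snd C D).mapCocone c) m.2
            fun n => congrArg (·.2) (h n)) } }⟩⟩

end Products

/-- In a symmetric monoidal closed category, `[Z, Z]` is terminal if `Z` is initial. Hence an
e-initial object is an e-zero object. -/
theorem HasEInitial.hasEZero {C : Type u} [Category.{v} C] [CPOCategory C] [MonoidalCategory C]
    [SymmetricCategory C] [MonoidalClosed C] (h : HasEInitial C) : HasEZero C := by
  obtain ⟨Z, ⟨hi⟩, he⟩ := h
  -- `X ⊗ -` is a left adjoint and so preserves the initial object; the braiding moves `Z` to the
  -- left factor.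
  have init : ∀ {X Y : C} (f g : Z ⊗ X ⟶ Y), f = g := by
    intro X Y f g
    have : (β_ X Z).hom ≫ f = (β_ X Z).hom ≫ g :=
      MonoidalClosed.curry_injective (hi.hom_ext _ _)
    exact (cancel_epi _).1 this
  let one : IsTerminal ((ihom Z).obj Z) := IsTerminal.ofUniqueHom
    (fun X => MonoidalClosed.curry ((β_ X Z).inv ≫ MonoidalClosed.uncurry (hi.to _)))
    fun X m => MonoidalClosed.uncurry_injective (init _ _)
  -- The embedding of `Z` in the terminal object `[Z, Z]` has a retraction, so it is an isomorphism.
  obtain ⟨p, hp, -⟩ := he _ (hi.to ((ihom Z).obj Z))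
  exact ⟨Z, ⟨hi⟩, ⟨one.ofIso ⟨p, hi.to _, one.hom_ext _ _, hp⟩⟩, he⟩

/-! ### Functorial expressions -/

theorem ωCPO.isCPOFunctor_tensor : IsCPOFunctor (MonoidalCategory.tensor ωCPO.{u}) := by
  intro X Y
  refine ωScottContinuous_continuousHom (f := fun f : X ⟶ Y =>
    (MonoidalCategory.tensor ωCPO.{u}).map f) fun x => ?_
  exact Prod.ωScottContinuous.prodMk
    (ContinuousHom.ωScottContinuous_apply (f := fun f : X ⟶ Y => f.1) Prod.ωScottContinuous_fst
      (g := fun _ => x.1) ωScottContinuous.const)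
    (ContinuousHom.ωScottContinuous_apply (f := fun f : X ⟶ Y => f.2) Prod.ωScottContinuous_snd
      (g := fun _ => x.2) ωScottContinuous.const)

theorem ωCPO.isCPOFunctor_sumFunctor : IsCPOFunctor ωCPO.sumFunctor.{u} := by
  intro X Y
  refine ωScottContinuous_continuousHom (f := fun f : X ⟶ Y => ωCPO.sumFunctor.map f) ?_
  rintro (x | x)
  · exact inl_continuous.comp
      (ContinuousHom.ωScottContinuous_apply (f := fun f : X ⟶ Y => f.1) Prod.ωScottContinuous_fst
        (g := fun _ => x) ωScottContinuous.const)
  · exact inr_continuous.comp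
      (ContinuousHom.ωScottContinuous_apply (f := fun f : X ⟶ Y => f.2) Prod.ωScottContinuous_snd
        (g := fun _ => x) ωScottContinuous.const)

/-- No guardedness is assumed, because the argument of a `T` in a guarded expression is arbitrary.
-/
theorem FunctorExpr.isCPOFunctor_interp {T : ωCPO.{u} ⥤ ωCPO.{u}} (hT : IsCPOFunctor T)
    (A : FunctorExpr.{u}) : IsCPOFunctor (A.interp T) := by
  induction A with
  | var => exact IsCPOFunctor.id
  | const c => exact IsCPOFunctor.const c
  | monad A ih => exact ih.comp hT
  | prod A B ihA ihB => exact (ihA.prod' ihB).comp ωCPO.isCPOFunctor_tensor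
  | sum A B ihA ihB => exact (ihA.prod' ihB).comp ωCPO.isCPOFunctor_sumFunctor

/-- A guarded expression over `T = F ⋙ G` denotes a functor that factors through a finite power of
the category in the middle. -/
theorem FunctorExpr.Guarded.exists_factorization {D : Type u} [Category.{v} D] [CPOCategory D]
    (hZ : HasEZero D) (hD : HasOmegaColimitsOverEmbeddings D) {F : ωCPO.{v} ⥤ D}
    {G : D ⥤ ωCPO.{v}} (hF : IsCPOFunctor F) (hG : IsCPOFunctor G) (A : FunctorExpr.{v})
    (hA : A.Guarded) :
    ∃ (E : Type u) (_ : Category.{v} E) (_ : CPOCategory E) (P : ωCPO.{v} ⥤ E)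
      (Q : E ⥤ ωCPO.{v}), HasEZero E ∧ HasOmegaColimitsOverEmbeddings E ∧ IsCPOFunctor P ∧
        IsCPOFunctor Q ∧ P ⋙ Q = A.interp (F ⋙ G) := by
  induction A with
  | var => exact hA.elim
  | const c =>
    exact ⟨D, _, _, F, (Functor.const D).obj c, hZ, hD, hF, IsCPOFunctor.const c, rfl⟩
  -- The induction hypothesis is of no help, as `A` need not be guarded; splitting the outermost `T`
  -- into `F` and `G` suffices.
  | monad A _ =>
    exact ⟨D, _, _, A.interp (F ⋙ G) ⋙ F, G, hZ, hD,
      (A.isCPOFunctor_interp (hF.comp hG)).comp hF, hG, rfl⟩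
  | prod A B ihA ihB =>
    obtain ⟨E, _, _, P, Q, hZE, hE, hP, hQ, hPQ⟩ := ihA hA.1
    obtain ⟨E', _, _, P', Q', hZE', hE', hP', hQ', hPQ'⟩ := ihB hA.2
    -- The two factors may pass through different powers of `D`, so the middle category grows to
    -- their product.
    refine ⟨E × E', inferInstance, inferInstance, Functor.prod' P P',
      Q.prod Q' ⋙ MonoidalCategory.tensor ωCPO, hZE.prod hZE', hE.prod hE', hP.prod' hP',
      (hQ.prod hQ').comp ωCPO.isCPOFunctor_tensor, ?_⟩
    rw [FunctorExpr.interp, ← hPQ, ← hPQ']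
    rfl
  | sum A B ihA ihB =>
    obtain ⟨E, _, _, P, Q, hZE, hE, hP, hQ, hPQ⟩ := ihA hA.1
    obtain ⟨E', _, _, P', Q', hZE', hE', hP', hQ', hPQ'⟩ := ihB hA.2
    refine ⟨E × E', inferInstance, inferInstance, Functor.prod' P P',
      Q.prod Q' ⋙ ωCPO.sumFunctor, hZE.prod hZE', hE.prod hE', hP.prod' hP',
      (hQ.prod hQ').comp ωCPO.isCPOFunctor_sumFunctor, ?_⟩
    rw [FunctorExpr.interp, ← hPQ, ← hPQ']
    rfl

theorem mainTheorem7 {D : Type u} [Category.{v} D] [CPOCategory D] [MonoidalCategory D]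
    [SymmetricCategory D] [MonoidalClosed D] (M : LNLFPCModel D)
    (A : FunctorExpr.{v}) (hA : A.Guarded) :
    AlgebraicallyCompact (A.interp M.T.toFunctor) := by
  obtain ⟨E, _, _, P, Q, hZ, hE, hP, hQ, hPQ⟩ := FunctorExpr.Guarded.exists_factorization
    M.eInitial.hasEZero M.colimits M.F_cpo M.G_cpo A hA
  have h : AlgebraicallyCompact (P ⋙ Q) :=
    AlgebraicallyCompact.comp_comm ((hQ.comp hP).algebraicallyCompact hE hZ)
  rwa [hPQ] at h
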